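/- Let $n\ge 3$ be an integer and let $K\subset\mathbb{R}^2$ be a convex body (a compact convex set with non-empty interior) that has $n$-fold rotational symmetry about the origin $o$, i.e. $K$ is mapped onto itself by the rotation about $o$ through the angle $2\pi/n$. Let $K^*=\{x\in\mathbb{R}^2 : \langle x,y\rangle\le 1 \text{ for all } y\in K\}$ be the polar body of $K$, and let $|\cdot|$ denote area. Then $$|K|\cdot|K^*|\ \ge\ n^2\sin^2(\pi/n),$$ with equality if and only if $K$ is a regular $n$-gon. -/

import Mathlib

open MeasureTheory

/-- The Euclidean plane. -/
abbrev Plane : Type := EuclideanSpace ℝ (Fin 2)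

/-- The (one-sided) polar of `K` with respect to the unit circle centred at the origin:
all `x` with `⟪x, y⟫ ≤ 1` for every `y ∈ K`. -/
def polarBody (K : Set Plane) : Set Plane :=
  {x | ∀ y ∈ K, inner ℝ x y ≤ 1}

/-- The counterclockwise rotation of the plane about the origin through the angle `θ`. -/
noncomputable def planeRotation (θ : ℝ) (x : Plane) : Plane :=
  !₂[Real.cos θ * x 0 - Real.sin θ * x 1, Real.sin θ * x 0 + Real.cos θ * x 1]

/-- `K` has `n`-fold rotational symmetry about the origin: the rotation about the origin through
the angle `2π/n` maps `K` onto itself. -/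
def HasRotationalSymmetry (n : ℕ) (K : Set Plane) : Prop :=
  planeRotation (2 * Real.pi / n) '' K = K

/-- `P` is a regular `n`-gon (of any centre `c`, circumradius `r > 0` and position `θ`): the convex
hull of `n` points that are equally spaced on a circle. -/
def IsRegularPolygon (n : ℕ) (P : Set Plane) : Prop :=
  ∃ (c : Plane) (r θ : ℝ), 0 < r ∧
    P = convexHull ℝ (Set.range fun k : Fin n =>
      c + r • (!₂[Real.cos (θ + 2 * Real.pi * k / n), Real.sin (θ + 2 * Real.pi * k / n)] : Plane))

/-! Write `R` for the rotation through 2π/n and `ρ` for the one through π/n. The heart of the proof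
is the inequality n sin(π/n) ⟪ρx, y⟫ ≤ |K| for all x, y ∈ K
(`HasRotationalSymmetry.inner_le_volume`). If y lies in the open sector between x and Rx, the
quadrilateral 0, x, y, Rx has area sin(π/n) ⟪ρx, y⟫, and its n rotated copies lie in K without
overlapping. The general case reduces to x on the boundary and y in that sector. The inequality says
that cρK ⊆ K* with c = n sin(π/n)/|K|; comparing areas gives the bound.

If equality holds, then K* = cρK, so each boundary point x has a y for which the quadrilaterals fill
K up to measure zero, hence entirely. The extreme points of K then lie in the orbits of x and one
other point, so there are finitely many. As the boundary is infinite, x can be chosen not extreme;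
then a single orbit remains, and K is its convex hull.

Conversely, symmetry forces a regular n-gon K to be centred at 0. For a vertex v and d =
cos(π/n)|v|², both K and dρK* lie in the union of the n central triangles, whose area is at most n
sin(π/n) d. Multiplying the two area bounds gives the reverse inequality. -/

/-- The determinant of the matrix with columns `u`, `v`. -/
def planeDet (u v : Plane) : ℝ := u 0 * v 1 - u 1 * v 0

/-- The linear endomorphism of the plane sending the standard basis to `u`, `v`. -/
noncomputable def basisMap (u v : Plane) : Plane →ₗ[ℝ] Plane where
  toFun p := p 0 • u + p 1 • v
  map_add' p q := by ext i; simp; ring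
  map_smul' c p := by ext i; simp; ring

theorem det_basisMap (u v : Plane) : LinearMap.det (basisMap u v) = planeDet u v := by
  rw [← LinearMap.det_toMatrix (EuclideanSpace.basisFun (Fin 2) ℝ).toBasis, Matrix.det_fin_two]
  simp [LinearMap.toMatrix_apply, basisMap, planeDet]
  ring

theorem planeRotation_apply_zero (θ : ℝ) (x : Plane) :
    planeRotation θ x 0 = Real.cos θ * x 0 - Real.sin θ * x 1 := by simp [planeRotation]

theorem planeRotation_apply_one (θ : ℝ) (x : Plane) :
    planeRotation θ x 1 = Real.sin θ * x 0 + Real.cos θ * x 1 := by simp [planeRotation]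

theorem plane_ext {x y : Plane} (h0 : x 0 = y 0) (h1 : x 1 = y 1) : x = y := by
  ext i; fin_cases i <;> assumption

theorem plane_inner (x y : Plane) : inner ℝ x y = x 0 * y 0 + x 1 * y 1 := by
  simp [PiLp.inner_apply, Fin.sum_univ_two]; ring

theorem plane_ne_zero {x : Plane} (hx : x ≠ 0) : 0 < x 0 ^ 2 + x 1 ^ 2 := by
  by_contra h
  apply hx
  apply plane_ext <;> simp <;> nlinarith [sq_nonneg (x 0), sq_nonneg (x 1)]

/-- `planeRotation` as a linear map. -/
noncomputable def rotationLin (θ : ℝ) : Plane →ₗ[ℝ] Plane :=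
  basisMap !₂[Real.cos θ, Real.sin θ] !₂[-Real.sin θ, Real.cos θ]

theorem rotationLin_apply (θ : ℝ) (x : Plane) : rotationLin θ x = planeRotation θ x := by
  apply plane_ext <;> simp [rotationLin, basisMap, planeRotation] <;> ring

theorem det_rotationLin (θ : ℝ) : LinearMap.det (rotationLin θ) = 1 := by
  rw [rotationLin, det_basisMap, planeDet]
  simp
  nlinarith [Real.sin_sq_add_cos_sq θ]

theorem planeRotation_add (θ : ℝ) (x y : Plane) :
    planeRotation θ (x + y) = planeRotation θ x + planeRotation θ y := by
  simp only [← rotationLin_apply, map_add]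

theorem planeRotation_smul (θ a : ℝ) (x : Plane) :
    planeRotation θ (a • x) = a • planeRotation θ x := by
  simp only [← rotationLin_apply, map_smul]

theorem planeRotation_rotation (θ φ : ℝ) (x : Plane) :
    planeRotation θ (planeRotation φ x) = planeRotation (θ + φ) x := by
  apply plane_ext <;>
    simp only [planeRotation_apply_zero, planeRotation_apply_one, Real.cos_add, Real.sin_add] <;>
    ring

theorem planeRotation_zero (x : Plane) : planeRotation 0 x = x := by
  apply plane_ext <;> simp [planeRotation]

theorem planeRotation_neg_cancel (θ : ℝ) (x : Plane) :
    planeRotation (-θ) (planeRotation θ x) = x := by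
  rw [planeRotation_rotation, neg_add_cancel, planeRotation_zero]

theorem planeRotation_cancel_neg (θ : ℝ) (x : Plane) :
    planeRotation θ (planeRotation (-θ) x) = x := by
  rw [planeRotation_rotation, add_neg_cancel, planeRotation_zero]

theorem planeRotation_two_pi (x : Plane) : planeRotation (2 * Real.pi) x = x := by
  apply plane_ext <;> simp [planeRotation]

theorem continuous_planeRotation (θ : ℝ) : Continuous (planeRotation θ) := by
  have : planeRotation θ = rotationLin θ := by ext1 x; rw [rotationLin_apply]
  rw [this]
  exact (rotationLin θ).continuous_of_finiteDimensional

theorem inner_planeRotation (θ : ℝ) (x y : Plane) :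
    inner ℝ (planeRotation θ x) (planeRotation θ y) = inner ℝ x y := by
  simp only [plane_inner, planeRotation_apply_zero, planeRotation_apply_one]
  linear_combination (x 0 * y 0 + x 1 * y 1) * Real.sin_sq_add_cos_sq θ

theorem planeDet_self_planeRotation (θ : ℝ) (x : Plane) :
    planeDet x (planeRotation θ x) = Real.sin θ * (x 0 ^ 2 + x 1 ^ 2) := by
  simp only [planeDet, planeRotation_apply_zero, planeRotation_apply_one]
  ring

theorem volume_image_smul_planeRotation (c θ : ℝ) (s : Set Plane) :
    volume ((fun x => c • planeRotation θ x) '' s) = ENNReal.ofReal (c ^ 2) * volume s := by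
  have : (fun x => c • planeRotation θ x) = (c • rotationLin θ : Plane →ₗ[ℝ] Plane) := by
    ext1 x; rw [LinearMap.smul_apply, rotationLin_apply]
  rw [this, Measure.addHaar_image_linearMap, LinearMap.det_smul, det_rotationLin]
  simp

/-! ### Triangles with a vertex at the origin and their areas. -/

/-- The open triangle with vertices `0`, `u`, `v`. -/
def openTriangle (u v : Plane) : Set Plane :=
  {p | ∃ a b : ℝ, 0 < a ∧ 0 < b ∧ a + b < 1 ∧ p = a • u + b • v}

/-- The closed triangle with vertices `0`, `u`, `v`. -/
def closedTriangle (u v : Plane) : Set Plane :=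
  {p | ∃ a b : ℝ, 0 ≤ a ∧ 0 ≤ b ∧ a + b ≤ 1 ∧ p = a • u + b • v}

theorem openTriangle_eq_image (u v : Plane) :
    openTriangle u v = basisMap u v '' {p | 0 < p 0 ∧ 0 < p 1 ∧ p 0 + p 1 < 1} := by
  ext p
  constructor
  · rintro ⟨a, b, ha, hb, hab, rfl⟩
    exact ⟨!₂[a, b], by simp [*], by simp [basisMap]⟩
  · rintro ⟨q, ⟨ha, hb, hab⟩, rfl⟩
    exact ⟨q 0, q 1, ha, hb, hab, rfl⟩

theorem closedTriangle_eq_image (u v : Plane) :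
    closedTriangle u v = basisMap u v '' {p | 0 ≤ p 0 ∧ 0 ≤ p 1 ∧ p 0 + p 1 ≤ 1} := by
  ext p
  constructor
  · rintro ⟨a, b, ha, hb, hab, rfl⟩
    exact ⟨!₂[a, b], by simp [*], by simp [basisMap]⟩
  · rintro ⟨q, ⟨ha, hb, hab⟩, rfl⟩
    exact ⟨q 0, q 1, ha, hb, hab, rfl⟩

theorem convex_openTriangle (u v : Plane) : Convex ℝ (openTriangle u v) := by
  rw [openTriangle_eq_image]
  apply Convex.linear_image
  have h0 : IsLinearMap ℝ (fun p : Plane => p 0) := ⟨fun _ _ => rfl, fun _ _ => rfl⟩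
  have h1 : IsLinearMap ℝ (fun p : Plane => p 1) := ⟨fun _ _ => rfl, fun _ _ => rfl⟩
  have h2 : IsLinearMap ℝ (fun p : Plane => p 0 + p 1) :=
    ⟨fun p q => by simp; ring, fun c p => by simp; ring⟩
  exact (convex_halfSpace_gt h0 0).inter ((convex_halfSpace_gt h1 0).inter
    (convex_halfSpace_lt h2 1))

theorem measurePreserving_plane_prod :
    MeasurePreserving (fun p : Plane => (p 0, p 1)) (volume : Measure Plane)
      (volume : Measure (ℝ × ℝ)) :=
  (volume_preserving_finTwoArrow ℝ).comp (PiLp.volume_preserving_ofLp (Fin 2))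

theorem volume_standard_openTriangle :
    volume {p : Plane | 0 < p 0 ∧ 0 < p 1 ∧ p 0 + p 1 < 1} = ENNReal.ofReal (1 / 2) := by
  have hR : {p : Plane | 0 < p 0 ∧ 0 < p 1 ∧ p 0 + p 1 < 1} = (fun p : Plane => (p 0, p 1)) ⁻¹'
      regionBetween (fun _ => 0) (fun t => 1 - t) (Set.Ioo (0 : ℝ) 1) := by
    ext p
    simp only [regionBetween, Set.mem_ofPred_eq, Set.mem_preimage, Set.mem_Ioo]
    constructor
    · rintro ⟨h1, h2, h3⟩; exact ⟨⟨h1, by linarith⟩, h2, by linarith⟩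
    · rintro ⟨⟨h1, _⟩, h2, h3⟩; exact ⟨h1, h2, by linarith⟩
  rw [hR, measurePreserving_plane_prod.measure_preimage
    (measurableSet_regionBetween (by fun_prop) (by fun_prop) measurableSet_Ioo).nullMeasurableSet]
  rw [Measure.volume_eq_prod, volume_regionBetween_eq_integral (by simp)
    ((by fun_prop : Continuous fun t : ℝ => 1 - t).integrableOn_Icc.mono_set
      Set.Ioo_subset_Icc_self) measurableSet_Ioo (fun x hx => by linarith [hx.2])]
  rw [← integral_Ioc_eq_integral_Ioo, ← intervalIntegral.integral_of_le zero_le_one]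
  congr 1
  simp only [Pi.sub_apply, sub_zero]
  rw [intervalIntegral.integral_sub (by simp) (by simp)]
  simp
  norm_num

/-- The open triangle reflected by p ↦ (1,1) − p is disjoint from the closed one and lies with it in
the unit square, leaving area at most 1 − 1/2. -/
theorem volume_standard_closedTriangle_le :
    volume {p : Plane | 0 ≤ p 0 ∧ 0 ≤ p 1 ∧ p 0 + p 1 ≤ 1} ≤ ENNReal.ofReal (1 / 2) := by
  set O : Set Plane := {p | 0 < p 0 ∧ 0 < p 1 ∧ p 0 + p 1 < 1}
  set C : Set Plane := {p | 0 ≤ p 0 ∧ 0 ≤ p 1 ∧ p 0 + p 1 ≤ 1}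
  have h0 : Continuous fun p : Plane => p 0 := by fun_prop
  have h1 : Continuous fun p : Plane => p 1 := by fun_prop
  have hO : IsOpen O := (isOpen_lt continuous_const h0).inter
    ((isOpen_lt continuous_const h1).inter (isOpen_lt (h0.add h1) continuous_const))
  set r : Plane → Plane := fun p => (!₂[1, 1] : Plane) - p
  have hr : MeasurePreserving r volume volume := Measure.measurePreserving_sub_left volume _
  have hO' : volume (r ⁻¹' O) = ENNReal.ofReal (1 / 2) := by
    rw [hr.measure_preimage hO.measurableSet.nullMeasurableSet, volume_standard_openTriangle]
  have hdisj : Disjoint C (r ⁻¹' O) := by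
    rw [Set.disjoint_left]
    rintro p ⟨-, -, hp⟩ ⟨-, -, hq⟩
    simp [r] at hq
    linarith
  have hsub : C ∪ r ⁻¹' O ⊆
      (fun p : Plane => (p 0, p 1)) ⁻¹' (Set.Icc (0 : ℝ) 1 ×ˢ Set.Icc (0 : ℝ) 1) := by
    rintro p (⟨ha, hb, hab⟩ | ⟨ha, hb, hab⟩)
    · exact ⟨⟨ha, by linarith⟩, hb, by linarith⟩
    · simp [r] at ha hb hab
      exact ⟨⟨by linarith, by linarith⟩, by simp; linarith, by simp; linarith⟩
  have hle : volume C + ENNReal.ofReal (1 / 2) ≤ 1 := by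
    rw [← hO', ← measure_union hdisj ((hO.preimage (by fun_prop)).measurableSet)]
    refine (measure_mono hsub).trans ?_
    rw [measurePreserving_plane_prod.measure_preimage
      (measurableSet_Icc.prod measurableSet_Icc).nullMeasurableSet, Measure.volume_eq_prod,
      Measure.prod_prod]
    simp
  have h1 : (1 : ENNReal) = ENNReal.ofReal (1 / 2) + ENNReal.ofReal (1 / 2) := by
    rw [← ENNReal.ofReal_add] <;> norm_num
  rw [h1] at hle
  exact (ENNReal.add_le_add_iff_right ENNReal.ofReal_ne_top).1 hle

theorem volume_openTriangle (u v : Plane) :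
    volume (openTriangle u v) = ENNReal.ofReal (|planeDet u v| / 2) := by
  rw [openTriangle_eq_image, Measure.addHaar_image_linearMap, det_basisMap,
    volume_standard_openTriangle, ← ENNReal.ofReal_mul (abs_nonneg _)]
  ring_nf

theorem volume_closedTriangle_le (u v : Plane) :
    volume (closedTriangle u v) ≤ ENNReal.ofReal (|planeDet u v| / 2) := by
  rw [closedTriangle_eq_image, Measure.addHaar_image_linearMap, det_basisMap]
  refine (mul_le_mul_right volume_standard_closedTriangle_le _).trans_eq ?_
  rw [← ENNReal.ofReal_mul (abs_nonneg _)]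
  ring_nf

/-! ### Polar coordinates and the decomposition of the plane into n sectors. -/

/-- The numbers s and φ are the modulus and argument of a + b·exp(iθ), hence independent of x. -/
theorem exists_smul_rotation_of_pos {θ a b : ℝ} (hθ0 : 0 < θ) (hθ : θ < Real.pi) (ha : 0 < a)
    (hb : 0 < b) :
    ∃ s φ : ℝ, 0 < s ∧ 0 < φ ∧ φ < θ ∧
      ∀ x : Plane, a • x + b • planeRotation θ x = s • planeRotation φ x := by
  set w : ℂ := ⟨a + b * Real.cos θ, b * Real.sin θ⟩ with hw
  have hsin : 0 < Real.sin θ := Real.sin_pos_of_pos_of_lt_pi hθ0 hθ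
  have hc : ‖w‖ * Real.cos w.arg = a + b * Real.cos θ := by rw [Complex.norm_mul_cos_arg]
  have hs : ‖w‖ * Real.sin w.arg = b * Real.sin θ := by rw [Complex.norm_mul_sin_arg]
  have hnorm : 0 < ‖w‖ := by
    rw [norm_pos_iff]
    intro h
    have : w.im = 0 := by rw [h]; rfl
    rw [hw] at this
    exact (mul_pos hb hsin).ne' this
  have hsinarg : 0 < Real.sin w.arg := by
    have : 0 < ‖w‖ * Real.sin w.arg := by rw [hs]; positivity
    exact pos_of_mul_pos_right this hnorm.le
  have hargpos : 0 < w.arg := by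
    by_contra h
    exact hsinarg.not_ge
      (Real.sin_nonpos_of_nonpos_of_neg_pi_le (not_lt.1 h) (Complex.neg_pi_lt_arg w).le)
  refine ⟨‖w‖, w.arg, hnorm, hargpos, ?_, fun x => ?_⟩
  · by_contra h
    have h1 : 0 ≤ Real.sin (w.arg - θ) :=
      Real.sin_nonneg_of_nonneg_of_le_pi (by linarith) (by linarith [Complex.arg_le_pi w])
    have h2 : ‖w‖ * Real.sin (w.arg - θ) = -(a * Real.sin θ) := by
      rw [Real.sin_sub]
      linear_combination Real.cos θ * hs - Real.sin θ * hc
    nlinarith [mul_nonneg hnorm.le h1, mul_pos ha hsin]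
  · apply plane_ext <;>
      simp only [PiLp.add_apply, PiLp.smul_apply, planeRotation_apply_zero,
        planeRotation_apply_one, smul_eq_mul]
    · linear_combination -x 0 * hc + x 1 * hs
    · linear_combination -x 1 * hc - x 0 * hs

theorem angle_eq_of_smul_rotation_eq {x : Plane} (hx : x ≠ 0) {s t A B : ℝ} (hs : 0 < s)
    (ht : 0 < t) (h : s • planeRotation A x = t • planeRotation B x) (h1 : A - B < 2 * Real.pi)
    (h2 : -(2 * Real.pi) < A - B) : A = B := by
  have hpos := plane_ne_zero hx
  have h' : s • planeRotation (A - B) x = t • x := by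
    have := congrArg (planeRotation (-B)) h
    rw [planeRotation_smul, planeRotation_smul, planeRotation_neg_cancel,
      planeRotation_rotation] at this
    rwa [sub_eq_neg_add]
  have e0 := congrArg (fun p : Plane => p 0) h'
  have e1 := congrArg (fun p : Plane => p 1) h'
  simp only [PiLp.smul_apply, planeRotation_apply_zero, planeRotation_apply_one,
    smul_eq_mul] at e0 e1
  have hc : s * Real.cos (A - B) = t := by
    apply mul_right_cancel₀ hpos.ne'
    linear_combination x 0 * e0 + x 1 * e1
  have hsn : s * Real.sin (A - B) = 0 := by
    apply mul_right_cancel₀ hpos.ne'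
    linear_combination x 0 * e1 - x 1 * e0
  have hsin : Real.sin (A - B) = 0 := (mul_eq_zero.1 hsn).resolve_left hs.ne'
  have hcpos : 0 < Real.cos (A - B) := pos_of_mul_pos_right (hc ▸ ht) hs.le
  have hcos : Real.cos (A - B) = 1 := by
    nlinarith [Real.sin_sq_add_cos_sq (A - B)]
  linarith [(Real.cos_eq_one_iff_of_lt_of_lt h2 h1).1 hcos]

/-- Measured from x, points of the j-th open sector have angle strictly between jθ and (j+1)θ; these
intervals are disjoint within one full turn. -/
theorem disjoint_rotated_sectors {n : ℕ} {θ : ℝ} (hθ0 : 0 < θ) (hθ : θ < Real.pi)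
    (hnθ : n * θ = 2 * Real.pi) {x : Plane} (hx : x ≠ 0) {j k : Fin n} {a b a' b' : ℝ}
    (ha : 0 < a) (hb : 0 < b) (ha' : 0 < a') (hb' : 0 < b')
    (h : planeRotation (j * θ) (a • x + b • planeRotation θ x) =
      planeRotation (k * θ) (a' • x + b' • planeRotation θ x)) : j = k := by
  obtain ⟨s, φ, hs, hφ0, hφ, e⟩ := exists_smul_rotation_of_pos hθ0 hθ ha hb
  obtain ⟨t, ψ, ht, hψ0, hψ, e'⟩ := exists_smul_rotation_of_pos hθ0 hθ ha' hb'
  rw [e, e', planeRotation_smul, planeRotation_smul, planeRotation_rotation,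
    planeRotation_rotation] at h
  have hj : (j : ℝ) + 1 ≤ n := by exact_mod_cast j.2
  have hk : (k : ℝ) + 1 ≤ n := by exact_mod_cast k.2
  have hj0 : (0 : ℝ) ≤ j := by positivity
  have hk0 : (0 : ℝ) ≤ k := by positivity
  have hA := angle_eq_of_smul_rotation_eq hx hs ht h (by nlinarith) (by nlinarith)
  have h1 : (j : ℝ) < k + 1 := by nlinarith
  have h2 : (k : ℝ) < j + 1 := by nlinarith
  have h1' : (j : ℕ) < k + 1 := by exact_mod_cast h1
  have h2' : (k : ℕ) < j + 1 := by exact_mod_cast h2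
  ext; omega

theorem exists_smul_rotation {v : Plane} (hv : v ≠ 0) (z : Plane) :
    ∃ s φ : ℝ, 0 ≤ s ∧ 0 ≤ φ ∧ φ < 2 * Real.pi ∧ z = s • planeRotation φ v := by
  have hpos := plane_ne_zero hv
  -- This is the complex quotient z/v.
  set w : ℂ := ⟨inner ℝ v z / (v 0 ^ 2 + v 1 ^ 2), planeDet v z / (v 0 ^ 2 + v 1 ^ 2)⟩
  have hz : z = ‖w‖ • planeRotation w.arg v := by
    have hc : ‖w‖ * Real.cos w.arg = inner ℝ v z / (v 0 ^ 2 + v 1 ^ 2) := by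
      rw [Complex.norm_mul_cos_arg]
    have hs : ‖w‖ * Real.sin w.arg = planeDet v z / (v 0 ^ 2 + v 1 ^ 2) := by
      rw [Complex.norm_mul_sin_arg]
    rw [eq_div_iff hpos.ne', plane_inner] at hc
    rw [eq_div_iff hpos.ne', planeDet] at hs
    apply plane_ext <;> apply mul_right_cancel₀ hpos.ne' <;>
      simp only [PiLp.smul_apply, planeRotation_apply_zero, planeRotation_apply_one, smul_eq_mul]
    · linear_combination -v 0 * hc + v 1 * hs
    · linear_combination -v 1 * hc - v 0 * hs
  by_cases h : 0 ≤ w.arg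
  · exact ⟨‖w‖, w.arg, norm_nonneg _, h, by linarith [Complex.arg_le_pi w, Real.pi_pos], hz⟩
  · refine ⟨‖w‖, w.arg + 2 * Real.pi, norm_nonneg _, ?_, by linarith, ?_⟩
    · linarith [Complex.neg_pi_lt_arg w, Real.pi_pos]
    · rw [← planeRotation_rotation, planeRotation_two_pi, ← hz]

theorem exists_rotated_sector {n : ℕ} {θ : ℝ} (hθ0 : 0 < θ) (hθ : θ < Real.pi)
    (hnθ : n * θ = 2 * Real.pi) {v : Plane} (hv : v ≠ 0) (z : Plane) :
    ∃ (k : Fin n) (a b : ℝ), 0 ≤ a ∧ 0 ≤ b ∧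
      z = planeRotation (k * θ) (a • v + b • planeRotation θ v) := by
  obtain ⟨s, φ, hs, hφ0, hφ, rfl⟩ := exists_smul_rotation hv z
  have hk1 : (⌊φ / θ⌋₊ : ℝ) * θ ≤ φ := (le_div_iff₀ hθ0).1 (Nat.floor_le (by positivity))
  have hk2 : φ < (⌊φ / θ⌋₊ + 1 : ℝ) * θ := (div_lt_iff₀ hθ0).1 (Nat.lt_floor_add_one _)
  have hkn : ⌊φ / θ⌋₊ < n := by
    have : (⌊φ / θ⌋₊ : ℝ) < n := by nlinarith
    exact_mod_cast this
  set ψ := φ - (⌊φ / θ⌋₊ : ℝ) * θ with hψ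
  have hsin : 0 < Real.sin θ := Real.sin_pos_of_pos_of_lt_pi hθ0 hθ
  -- Coefficients from the sine rule: sin θ times v turned by ψ equals sin(θ − ψ) v + sin ψ times v
  -- turned by θ.
  refine ⟨⟨_, hkn⟩, s * (Real.sin (θ - ψ) / Real.sin θ), s * (Real.sin ψ / Real.sin θ), ?_, ?_, ?_⟩
  · exact mul_nonneg hs (div_nonneg
      (Real.sin_nonneg_of_nonneg_of_le_pi (by linarith) (by linarith)) hsin.le)
  · exact mul_nonneg hs (div_nonneg
      (Real.sin_nonneg_of_nonneg_of_le_pi (by linarith) (by linarith)) hsin.le)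
  · have hφψ : φ = (⌊φ / θ⌋₊ : ℝ) * θ + ψ := by rw [hψ]; ring
    conv_lhs => rw [hφψ]
    rw [← planeRotation_rotation, ← planeRotation_smul]
    congr 1
    apply plane_ext <;>
      simp only [PiLp.add_apply, PiLp.smul_apply, planeRotation_apply_zero,
        planeRotation_apply_one, smul_eq_mul, Real.sin_sub] <;>
      field_simp <;> ring

/-! ### Area of the rotated quadrilaterals. -/

theorem image_planeRotation_openTriangle (φ : ℝ) (u v : Plane) :
    planeRotation φ '' openTriangle u v =
      openTriangle (planeRotation φ u) (planeRotation φ v) := by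
  ext p
  constructor
  · rintro ⟨_, ⟨a, b, ha, hb, hab, rfl⟩, rfl⟩
    exact ⟨a, b, ha, hb, hab, by simp only [planeRotation_add, planeRotation_smul]⟩
  · rintro ⟨a, b, ha, hb, hab, rfl⟩
    exact ⟨_, ⟨a, b, ha, hb, hab, rfl⟩, by simp only [planeRotation_add, planeRotation_smul]⟩

theorem volume_image_planeRotation (θ : ℝ) (s : Set Plane) :
    volume (planeRotation θ '' s) = volume s := by
  simpa using volume_image_smul_planeRotation 1 θ s

theorem convex_image_planeRotation (θ : ℝ) {s : Set Plane} (hs : Convex ℝ s) :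
    Convex ℝ (planeRotation θ '' s) := by
  have : planeRotation θ = rotationLin θ := by ext1 x; rw [rotationLin_apply]
  rw [this]
  exact hs.linear_image _

/-- The left side is det(x − x', y) with x' the rotation of x through 2φ. The chord x' − x is
perpendicular to the bisecting direction, that of x turned by φ, and has length 2|sin φ||x|. -/
theorem planeDet_add_planeDet_rotation (φ : ℝ) (x y : Plane) :
    planeDet x y + planeDet y (planeRotation (2 * φ) x) =
      2 * Real.sin φ * inner ℝ (planeRotation φ x) y := by
  simp only [planeDet, plane_inner, planeRotation_apply_zero, planeRotation_apply_one,
    Real.sin_two_mul, Real.cos_two_mul']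
  linear_combination (x 0 * y 1 - x 1 * y 0) * (Real.sin_sq_add_cos_sq φ).symm

/-- If the star-shaped quadrilateral `0, x, y, Rx` lies in the sector spanned by `x` and `Rx`, where
`R` is the rotation through `2π/n`, then the rotated copies of this quadrilateral do not overlap. -/
theorem volume_iUnion_rotated_triangles {n : ℕ} (hn : 3 ≤ n) {x y : Plane} (hx : x ≠ 0)
    {α β : ℝ} (hα : 0 < α) (hβ : 0 < β)
    (hy : y = α • x + β • planeRotation (2 * Real.pi / n) x) :
    volume (⋃ k : Fin n, planeRotation (k * (2 * Real.pi / n)) ''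
      (openTriangle x y ∪ openTriangle y (planeRotation (2 * Real.pi / n) x))) =
    ENNReal.ofReal (n * Real.sin (Real.pi / n) * inner ℝ (planeRotation (Real.pi / n) x) y) := by
  set θ := 2 * Real.pi / n with hθdef
  have hn3 : (3 : ℝ) ≤ n := by exact_mod_cast hn
  have hπ := Real.pi_pos
  have hn0 : (n : ℝ) ≠ 0 := by positivity
  have hnθ : n * θ = 2 * Real.pi := by rw [hθdef]; field_simp
  have hθ0 : 0 < θ := by positivity
  have hθ : θ < Real.pi := by rw [hθdef, div_lt_iff₀ (by positivity)]; nlinarith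
  have hsin : 0 < Real.sin θ := Real.sin_pos_of_pos_of_lt_pi hθ0 hθ
  have hpos := plane_ne_zero hx
  have hdx : planeDet x y = β * (Real.sin θ * (x 0 ^ 2 + x 1 ^ 2)) := by
    rw [← planeDet_self_planeRotation, hy]; simp [planeDet]; ring
  have hdy : planeDet y (planeRotation θ x) = α * (Real.sin θ * (x 0 ^ 2 + x 1 ^ 2)) := by
    rw [← planeDet_self_planeRotation, hy]; simp [planeDet]; ring
  have hdx0 : 0 < planeDet x y := by rw [hdx]; positivity
  have hdy0 : 0 < planeDet y (planeRotation θ x) := by rw [hdy]; positivity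
  have hsec : ∀ p ∈ openTriangle x y ∪ openTriangle y (planeRotation θ x),
      ∃ a b : ℝ, 0 < a ∧ 0 < b ∧ p = a • x + b • planeRotation θ x := by
    rintro p (⟨a, b, ha, hb, -, rfl⟩ | ⟨a, b, ha, hb, -, rfl⟩)
    · refine ⟨a + b * α, b * β, by positivity, by positivity, ?_⟩
      rw [hy]; module
    · refine ⟨a * α, b + a * β, by positivity, by positivity, ?_⟩
      rw [hy]; module
  have hdisj : Disjoint (openTriangle x y) (openTriangle y (planeRotation θ x)) := by
    rw [Set.disjoint_left]
    rintro p ⟨a, b, ha, hb, -, hp⟩ ⟨a', b', ha', hb', -, hq⟩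
    have h1 : planeDet y p = -(a * planeDet x y) := by rw [hp]; simp [planeDet]; ring
    have h2 : planeDet y p = b' * planeDet y (planeRotation θ x) := by
      rw [hq]; simp [planeDet]; ring
    nlinarith [mul_pos ha hdx0, mul_pos hb' hdy0]
  have hvol : volume (openTriangle x y ∪ openTriangle y (planeRotation θ x)) =
      ENNReal.ofReal (Real.sin (Real.pi / n) * inner ℝ (planeRotation (Real.pi / n) x) y) := by
    rw [measure_union₀ ((convex_openTriangle _ _).nullMeasurableSet volume) hdisj.aedisjoint,
      volume_openTriangle, volume_openTriangle, abs_of_pos hdx0, abs_of_pos hdy0,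
      ← ENNReal.ofReal_add (by positivity) (by positivity)]
    congr 1
    have := planeDet_add_planeDet_rotation (Real.pi / n) x y
    rw [show 2 * (Real.pi / n) = θ by rw [hθdef]; ring] at this
    linear_combination this / 2
  rw [measure_iUnion₀]
  · simp only [volume_image_planeRotation, hvol, tsum_fintype, Finset.sum_const, Finset.card_univ,
      Fintype.card_fin]
    rw [nsmul_eq_mul, mul_assoc, ENNReal.ofReal_mul (Nat.cast_nonneg n), ENNReal.ofReal_natCast]
  · intro j k hjk
    apply Disjoint.aedisjoint
    rw [Set.disjoint_left]
    rintro _ ⟨p, hp, rfl⟩ ⟨q, hq, hqp⟩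
    obtain ⟨a, b, ha, hb, rfl⟩ := hsec p hp
    obtain ⟨a', b', ha', hb', rfl⟩ := hsec q hq
    exact hjk (disjoint_rotated_sectors hθ0 hθ hnθ hx ha hb ha' hb' hqp.symm)
  · intro k
    rw [Set.image_union]
    exact ((convex_image_planeRotation _ (convex_openTriangle _ _)).nullMeasurableSet _).union
      ((convex_image_planeRotation _ (convex_openTriangle _ _)).nullMeasurableSet _)

/-! ### Consequences of rotational symmetry. -/

theorem HasRotationalSymmetry.planeRotation_mem {n : ℕ} {K : Set Plane}
    (h : HasRotationalSymmetry n K) {x : Plane} (hx : x ∈ K) (k : ℕ) :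
    planeRotation (k * (2 * Real.pi / n)) x ∈ K := by
  induction k with
  | zero => simpa [planeRotation_zero] using hx
  | succ k ih =>
    have := Set.mem_image_of_mem (planeRotation (2 * Real.pi / n)) ih
    rw [h, planeRotation_rotation] at this
    convert this using 2
    push_cast; ring

theorem HasRotationalSymmetry.planeRotation_neg_mem {n : ℕ} {K : Set Plane}
    (h : HasRotationalSymmetry n K) {x : Plane} (hx : x ∈ K) (k : ℕ) :
    planeRotation (-(k * (2 * Real.pi / n))) x ∈ K := by
  induction k with
  | zero => simpa [planeRotation_zero] using hx
  | succ k ih =>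
    rw [← h] at ih
    obtain ⟨y, hy, hyx⟩ := ih
    convert hy using 1
    rw [← planeRotation_neg_cancel (2 * Real.pi / n) y, hyx, planeRotation_rotation]
    congr 1
    push_cast; ring

theorem HasRotationalSymmetry.step_mem {n : ℕ} {K : Set Plane}
    (h : HasRotationalSymmetry n K) {x : Plane} (hx : x ∈ K) :
    planeRotation (2 * Real.pi / n) x ∈ K := by
  simpa using h.planeRotation_mem hx 1

theorem two_pi_div_bounds {n : ℕ} (hn : 3 ≤ n) :
    0 < 2 * Real.pi / n ∧ 2 * Real.pi / n < Real.pi ∧ n * (2 * Real.pi / n) = 2 * Real.pi := by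
  have hn3 : (3 : ℝ) ≤ n := by exact_mod_cast hn
  have hπ := Real.pi_pos
  refine ⟨by positivity, ?_, by field_simp⟩
  rw [div_lt_iff₀ (by positivity)]; nlinarith

theorem sin_pi_div_pos {n : ℕ} (hn : 3 ≤ n) : 0 < Real.sin (Real.pi / n) := by
  obtain ⟨h1, h2, -⟩ := two_pi_div_bounds hn
  have : Real.pi / n = (2 * Real.pi / n) / 2 := by ring
  exact Real.sin_pos_of_pos_of_lt_pi (by linarith) (by linarith)

theorem cos_pi_div_pos {n : ℕ} (hn : 3 ≤ n) : 0 < Real.cos (Real.pi / n) := by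
  obtain ⟨h1, h2, -⟩ := two_pi_div_bounds hn
  have : Real.pi / n = (2 * Real.pi / n) / 2 := by ring
  exact Real.cos_pos_of_mem_Ioo ⟨by linarith, by linarith⟩

theorem eq_zero_of_planeRotation_eq {n : ℕ} (hn : 3 ≤ n) {q : Plane}
    (h : planeRotation (2 * Real.pi / n) q = q) : q = 0 := by
  obtain ⟨h1, h2, -⟩ := two_pi_div_bounds hn
  by_contra hq
  have := angle_eq_of_smul_rotation_eq hq one_pos one_pos
    (A := 2 * Real.pi / n) (B := 0) (by rw [h, planeRotation_zero]) (by linarith) (by linarith)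
  linarith

/-- Rotation through 2π/n permutes the summands cyclically, so it fixes the sum; its only fixed
point is 0. -/
theorem sum_rotations_eq_zero {n : ℕ} (hn : 3 ≤ n) (p : Plane) :
    ∑ k ∈ Finset.range n, planeRotation (k * (2 * Real.pi / n)) p = 0 := by
  obtain ⟨h1, h2, h3⟩ := two_pi_div_bounds hn
  apply eq_zero_of_planeRotation_eq hn
  have h := Finset.sum_range_succ
    (fun k : ℕ => planeRotation (k * (2 * Real.pi / n)) p) n
  rw [Finset.sum_range_succ'] at h
  simp only [h3, planeRotation_two_pi, Nat.cast_zero, zero_mul, planeRotation_zero] at h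
  conv_rhs => rw [← add_right_cancel h]
  rw [← rotationLin_apply, map_sum]
  refine Finset.sum_congr rfl fun k _ => ?_
  rw [rotationLin_apply, planeRotation_rotation]
  congr 1
  push_cast; ring

/-- The origin is the average of the orbit of an interior point, and the interior is convex and
invariant. -/
theorem HasRotationalSymmetry.zero_mem_interior {n : ℕ} (hn : 3 ≤ n) {K : Set Plane}
    (h : HasRotationalSymmetry n K) (hK : Convex ℝ K) (hint : (interior K).Nonempty) :
    (0 : Plane) ∈ interior K := by
  obtain ⟨p, hp⟩ := hint
  have hmem : ∀ k : ℕ, planeRotation (k * (2 * Real.pi / n)) p ∈ interior K := by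
    intro k
    have hsub : planeRotation (-(k * (2 * Real.pi / n))) ⁻¹' interior K ⊆ K := fun z hz => by
      rw [← planeRotation_cancel_neg (k * (2 * Real.pi / n)) z]
      exact h.planeRotation_mem (interior_subset hz) k
    refine interior_maximal hsub (isOpen_interior.preimage (continuous_planeRotation _)) ?_
    rw [Set.mem_preimage, planeRotation_neg_cancel]
    exact hp
  have hn0 : (n : ℝ) ≠ 0 := by positivity
  have := hK.interior.sum_mem (t := Finset.range n) (w := fun _ => (1 / n : ℝ))
    (z := fun k => planeRotation (k * (2 * Real.pi / n)) p) (fun _ _ => by positivity)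
    (by simp [hn0]) (fun k _ => hmem k)
  rwa [← Finset.smul_sum, sum_rotations_eq_zero hn, smul_zero] at this

/-! ### The key inequality between ⟪ρx, y⟫ and the area of K. -/

theorem smul_mem_interior_of_lt_one {K : Set Plane} (hK : Convex ℝ K) (h0 : (0 : Plane) ∈ interior K)
    {x : Plane} (hx : x ∈ K) {s : ℝ} (hs0 : 0 ≤ s) (hs : s < 1) : s • x ∈ interior K := by
  have := hK.combo_interior_self_mem_interior h0 hx (a := 1 - s) (b := s) (by linarith) hs0
    (by ring)
  simpa using this

theorem exists_sector_coordinates {n : ℕ} (hn : 3 ≤ n) {x : Plane} (hx : x ≠ 0) (y : Plane) :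
    ∃ α β : ℝ, y = α • x + β • planeRotation (2 * Real.pi / n) x := by
  obtain ⟨h1, h2, -⟩ := two_pi_div_bounds hn
  set θ := 2 * Real.pi / n
  have hd : 0 < planeDet x (planeRotation θ x) := by
    rw [planeDet_self_planeRotation]
    exact mul_pos (Real.sin_pos_of_pos_of_lt_pi h1 h2) (plane_ne_zero hx)
  refine ⟨planeDet y (planeRotation θ x) / planeDet x (planeRotation θ x),
    planeDet x y / planeDet x (planeRotation θ x), ?_⟩
  apply plane_ext <;> apply mul_left_cancel₀ hd.ne' <;>
    simp only [PiLp.add_apply, PiLp.smul_apply, smul_eq_mul, mul_add, ← mul_assoc,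
      mul_div_cancel₀ _ hd.ne'] <;>
    simp only [planeDet] <;> ring

/-- By reflection in the bisector, x and Rx have the same inner product with ρx. So the functional
⟪ρx, ·⟫ sees only α + β, and the chord from x to Rx lies on α + β = 1. -/
theorem inner_rotation_sector (n : ℕ) (x : Plane) (α β : ℝ) :
    inner ℝ (planeRotation (Real.pi / n) x) (α • x + β • planeRotation (2 * Real.pi / n) x) =
      (α + β) * (Real.cos (Real.pi / n) * (x 0 ^ 2 + x 1 ^ 2)) := by
  have : 2 * Real.pi / n = 2 * (Real.pi / n) := by ring
  rw [this]
  simp only [plane_inner, PiLp.add_apply, PiLp.smul_apply, planeRotation_apply_zero,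
    planeRotation_apply_one, Real.sin_two_mul, Real.cos_two_mul', smul_eq_mul]
  linear_combination (β * Real.cos (Real.pi / n) * (x 0 ^ 2 + x 1 ^ 2)) *
    (Real.sin_sq_add_cos_sq (Real.pi / n))

/-- A point of `K` beyond the chord from a boundary point `x` to its rotation `Rx` lies in the open
sector spanned by `x` and `Rx`. -/
theorem HasRotationalSymmetry.coordinates_pos {n : ℕ} {K : Set Plane}
    (h : HasRotationalSymmetry n K) (hK : Convex ℝ K) (h0 : (0 : Plane) ∈ interior K)
    {x : Plane} (hx : x ∈ K) (hxi : x ∉ interior K) {α β : ℝ}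
    (hy : α • x + β • planeRotation (2 * Real.pi / n) x ∈ K) (hαβ : 1 < α + β) :
    0 < α ∧ 0 < β := by
  set θ := 2 * Real.pi / n
  have hRx : planeRotation θ x ∈ K := h.step_mem hx
  -- Adding −b times v to the given point and dividing by 1 − b shows that (a/(1 − b)) u ∈ K. Since
  -- a > 1 − b, this is u stretched by a factor above 1, so u is interior.
  have key : ∀ {a b : ℝ} {u v : Plane}, u ∈ K → v ∈ K → a • u + b • v ∈ K → 1 < a + b → b ≤ 0 →
      u ∈ interior K := by
    intro a b u v hu hv hw hab hb
    have ha : 0 < a := by linarith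
    have h1b : 0 < 1 - b := by linarith
    have hc : (1 / (1 - b)) • (a • u + b • v) + (-b / (1 - b)) • v ∈ K :=
      hK hw hv (by positivity) (div_nonneg (by linarith) h1b.le) (by field_simp; ring)
    have := smul_mem_interior_of_lt_one hK h0 hc (s := (1 - b) / a) (by positivity)
      (by rw [div_lt_one ha]; linarith)
    convert this using 1
    have e1 : (1 - b) / a * (1 / (1 - b)) * a = 1 := by field_simp
    have e2 : (1 - b) / a * (1 / (1 - b)) * b + (1 - b) / a * (-b / (1 - b)) = 0 := by
      field_simp; ring
    have e0 : ((1 - b) / a) • ((1 / (1 - b)) • (a • u + b • v) + (-b / (1 - b)) • v) =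
        ((1 - b) / a * (1 / (1 - b)) * a) • u +
          ((1 - b) / a * (1 / (1 - b)) * b + (1 - b) / a * (-b / (1 - b))) • v := by module
    rw [e0, e1, one_smul, e2, zero_smul, add_zero]
  constructor
  · by_contra hα
    have hR := key hRx hx (a := β) (b := α) (by rwa [add_comm]) (by linarith) (not_lt.1 hα)
    apply hxi
    -- The interior is invariant under R, so Rx interior would make x interior.
    have hsub : planeRotation θ ⁻¹' interior K ⊆ K := fun z hz => by
      rw [← planeRotation_neg_cancel θ z]
      simpa using h.planeRotation_neg_mem (interior_subset hz) 1
    exact interior_maximal hsub (isOpen_interior.preimage (continuous_planeRotation _)) hR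
  · by_contra hβ
    exact hxi (key hx hRx hy hαβ (not_lt.1 hβ))

theorem ne_zero_of_notMem_interior {K : Set Plane} (h0 : (0 : Plane) ∈ interior K) {x : Plane}
    (hxi : x ∉ interior K) : x ≠ 0 := by
  rintro rfl; exact hxi h0

/-- A point y beyond the chord from x to Rx is already in the sector. Any other y can be replaced by
the midpoint of the chord, which does not decrease ⟪ρx, ·⟫. -/
theorem HasRotationalSymmetry.exists_mem_sector {n : ℕ} (hn : 3 ≤ n) {K : Set Plane}
    (h : HasRotationalSymmetry n K) (hK : Convex ℝ K) (h0 : (0 : Plane) ∈ interior K)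
    {x : Plane} (hx : x ∈ K) (hxi : x ∉ interior K) {y : Plane} (hy : y ∈ K) :
    ∃ α β : ℝ, 0 < α ∧ 0 < β ∧ α • x + β • planeRotation (2 * Real.pi / n) x ∈ K ∧
      inner ℝ (planeRotation (Real.pi / n) x) y ≤ inner ℝ (planeRotation (Real.pi / n) x)
        (α • x + β • planeRotation (2 * Real.pi / n) x) := by
  have hx0 := ne_zero_of_notMem_interior h0 hxi
  obtain ⟨α, β, rfl⟩ := exists_sector_coordinates hn hx0 y
  by_cases hαβ : 1 < α + β
  · obtain ⟨hα, hβ⟩ := h.coordinates_pos hK h0 hx hxi hy hαβ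
    exact ⟨α, β, hα, hβ, hy, le_rfl⟩
  · refine ⟨1 / 2, 1 / 2, by norm_num, by norm_num,
      hK hx (h.step_mem hx) (by norm_num) (by norm_num) (by norm_num), ?_⟩
    rw [inner_rotation_sector, inner_rotation_sector]
    have := mul_pos (cos_pi_div_pos hn) (plane_ne_zero hx0)
    nlinarith

theorem openTriangle_subset {K : Set Plane} (hK : Convex ℝ K) (h0 : (0 : Plane) ∈ K) {u v : Plane}
    (hu : u ∈ K) (hv : v ∈ K) : openTriangle u v ⊆ K := by
  rintro _ ⟨a, b, ha, hb, hab, rfl⟩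
  have := hK.sum_mem (t := Finset.univ) (w := ![1 - a - b, a, b]) (z := ![0, u, v])
    (by intro i _; fin_cases i <;> simp <;> linarith)
    (by simp [Fin.sum_univ_three]; ring) (by intro i _; fin_cases i <;> simpa)
  simpa [Fin.sum_univ_three] using this

theorem HasRotationalSymmetry.iUnion_rotated_triangles_subset {n : ℕ} {K : Set Plane}
    (h : HasRotationalSymmetry n K) (hK : Convex ℝ K) (h0 : (0 : Plane) ∈ K) {x y : Plane}
    (hx : x ∈ K) (hy : y ∈ K) :
    (⋃ k : Fin n, planeRotation (k * (2 * Real.pi / n)) ''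
      (openTriangle x y ∪ openTriangle y (planeRotation (2 * Real.pi / n) x))) ⊆ K := by
  refine Set.iUnion_subset fun k => ?_
  rintro _ ⟨p, hp | hp, rfl⟩
  · exact h.planeRotation_mem (openTriangle_subset hK h0 hx hy hp) k
  · exact h.planeRotation_mem (openTriangle_subset hK h0 hy (h.step_mem hx) hp) k

theorem HasRotationalSymmetry.inner_le_volume_of_boundary {n : ℕ} (hn : 3 ≤ n) {K : Set Plane}
    (h : HasRotationalSymmetry n K) (hK : Convex ℝ K) (hc : IsCompact K)
    (h0 : (0 : Plane) ∈ interior K) {x y : Plane} (hx : x ∈ K) (hxi : x ∉ interior K)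
    (hy : y ∈ K) :
    n * Real.sin (Real.pi / n) * inner ℝ (planeRotation (Real.pi / n) x) y ≤ volume.real K := by
  obtain ⟨α, β, hα, hβ, hmem, hle⟩ := h.exists_mem_sector hn hK h0 hx hxi hy
  have hs := sin_pi_div_pos hn
  refine (mul_le_mul_of_nonneg_left hle (by positivity)).trans ?_
  rw [Measure.real, ← ENNReal.ofReal_le_iff_le_toReal hc.measure_lt_top.ne,
    ← volume_iUnion_rotated_triangles hn (ne_zero_of_notMem_interior h0 hxi) hα hβ rfl]
  exact measure_mono (h.iUnion_rotated_triangles_subset hK (interior_subset h0) hx hmem)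

theorem exists_one_lt_smul_mem {K : Set Plane} {x : Plane} (hx : x ∈ interior K) :
    ∃ t : ℝ, 1 < t ∧ t • x ∈ K := by
  have hcont : Filter.Tendsto (fun t : ℝ => t • x) (nhds 1) (nhds x) := by
    have : Continuous fun t : ℝ => t • x := by fun_prop
    simpa using this.tendsto 1
  have hev : ∀ᶠ t in nhds (1 : ℝ), t • x ∈ K := hcont (mem_interior_iff_mem_nhds.1 hx)
  have hev' : ∀ᶠ t in nhdsWithin (1 : ℝ) (Set.Ioi 1), t • x ∈ K := hev.filter_mono inf_le_left
  obtain ⟨t, ht, ht1⟩ := (hev'.and self_mem_nhdsWithin).exists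
  exact ⟨t, ht1, ht⟩

/-- For fixed y, replace x by a maximiser z. If z is interior it can be stretched inside K, so the
maximum is nonpositive and the bound is trivial; otherwise z is a boundary point. -/
theorem HasRotationalSymmetry.inner_le_volume {n : ℕ} (hn : 3 ≤ n) {K : Set Plane}
    (h : HasRotationalSymmetry n K) (hK : Convex ℝ K) (hc : IsCompact K)
    (h0 : (0 : Plane) ∈ interior K) {x y : Plane} (hx : x ∈ K) (hy : y ∈ K) :
    n * Real.sin (Real.pi / n) * inner ℝ (planeRotation (Real.pi / n) x) y ≤ volume.real K := by
  have hs := sin_pi_div_pos hn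
  obtain ⟨z, hz, hmax⟩ := hc.exists_isMaxOn (f := fun x => inner ℝ (planeRotation (Real.pi / n) x) y)
    ⟨x, hx⟩ ((continuous_planeRotation _).inner continuous_const).continuousOn
  have hxz : inner ℝ (planeRotation (Real.pi / n) x) y ≤ inner ℝ (planeRotation (Real.pi / n) z) y :=
    hmax hx
  refine (mul_le_mul_of_nonneg_left hxz (by positivity)).trans ?_
  by_cases hzi : z ∈ interior K
  · obtain ⟨t, ht, htK⟩ := exists_one_lt_smul_mem hzi
    have h1 : inner ℝ (planeRotation (Real.pi / n) (t • z)) y ≤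
      inner ℝ (planeRotation (Real.pi / n) z) y := hmax htK
    rw [planeRotation_smul, real_inner_smul_left] at h1
    have h2 : inner ℝ (planeRotation (Real.pi / n) z) y ≤ 0 := by nlinarith
    exact (mul_nonpos_of_nonneg_of_nonpos (by positivity) h2).trans measureReal_nonneg
  · exact h.inner_le_volume_of_boundary hn hK hc h0 hz hzi hy

/-! ### The polar body and the lower bound. -/

theorem isClosed_polarBody (K : Set Plane) : IsClosed (polarBody K) := by
  have : polarBody K = ⋂ y ∈ K, {x | inner ℝ x y ≤ 1} := by ext; simp [polarBody]
  rw [this]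
  exact isClosed_biInter fun y _ =>
    isClosed_le (continuous_id.inner continuous_const) continuous_const

theorem convex_polarBody (K : Set Plane) : Convex ℝ (polarBody K) := by
  intro x hx y hy a b ha hb hab z hz
  rw [inner_add_left, real_inner_smul_left, real_inner_smul_left]
  nlinarith [hx z hz, hy z hz]

theorem isBounded_polarBody {K : Set Plane} (h0 : (0 : Plane) ∈ interior K) :
    Bornology.IsBounded (polarBody K) := by
  obtain ⟨δ, hδ, hball⟩ := Metric.mem_nhds_iff.1 (mem_interior_iff_mem_nhds.1 h0)
  refine (Metric.isBounded_closedBall (x := (0 : Plane)) (r := 2 / δ)).subset fun x hx => ?_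
  rw [mem_closedBall_zero_iff]
  by_cases hx0 : x = 0
  · rw [hx0, norm_zero]; positivity
  · have hn : 0 < ‖x‖ := norm_pos_iff.2 hx0
    have hmem : (δ / 2 / ‖x‖) • x ∈ K := by
      apply hball
      rw [mem_ball_zero_iff, norm_smul, Real.norm_of_nonneg (by positivity),
        div_mul_cancel₀ _ hn.ne']
      linarith
    have := hx _ hmem
    rw [real_inner_smul_right, real_inner_self_eq_norm_sq] at this
    rw [le_div_iff₀ hδ]
    have e : δ / 2 / ‖x‖ * ‖x‖ ^ 2 = δ / 2 * ‖x‖ := by field_simp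
    rw [e] at this
    linarith

theorem volume_real_pos {K : Set Plane} (hc : IsCompact K) (hint : (interior K).Nonempty) :
    0 < volume.real K :=
  ENNReal.toReal_pos (Measure.measure_pos_of_nonempty_interior _ hint).ne' hc.measure_lt_top.ne

theorem volume_real_image_smul_planeRotation (c θ : ℝ) (s : Set Plane) :
    volume.real ((fun x => c • planeRotation θ x) '' s) = c ^ 2 * volume.real s := by
  rw [Measure.real, volume_image_smul_planeRotation, ENNReal.toReal_mul,
    ENNReal.toReal_ofReal (sq_nonneg c), Measure.real]

/-- The polar body contains a dilated copy of `K` rotated through `π/n`. -/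
theorem HasRotationalSymmetry.image_subset_polarBody {n : ℕ} (hn : 3 ≤ n) {K : Set Plane}
    (h : HasRotationalSymmetry n K) (hK : Convex ℝ K) (hc : IsCompact K)
    (h0 : (0 : Plane) ∈ interior K) :
    (fun x => (n * Real.sin (Real.pi / n) / volume.real K) • planeRotation (Real.pi / n) x) '' K ⊆
      polarBody K := by
  rintro _ ⟨x, hx, rfl⟩ y hy
  have hv := volume_real_pos hc ⟨0, h0⟩
  rw [real_inner_smul_left, div_mul_eq_mul_div, div_le_one hv]
  exact h.inner_le_volume hn hK hc h0 hx hy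

theorem HasRotationalSymmetry.volume_product_ge {n : ℕ} (hn : 3 ≤ n) {K : Set Plane}
    (h : HasRotationalSymmetry n K) (hK : Convex ℝ K) (hc : IsCompact K)
    (h0 : (0 : Plane) ∈ interior K) :
    (n : ℝ) ^ 2 * Real.sin (Real.pi / n) ^ 2 ≤ volume.real K * volume.real (polarBody K) := by
  have hv := volume_real_pos hc ⟨0, h0⟩
  have hle := measureReal_mono (μ := volume) (h.image_subset_polarBody hn hK hc h0)
    (isBounded_polarBody h0).measure_lt_top.ne
  rw [volume_real_image_smul_planeRotation] at hle
  calc (n : ℝ) ^ 2 * Real.sin (Real.pi / n) ^ 2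
      = volume.real K * ((n * Real.sin (Real.pi / n) / volume.real K) ^ 2 * volume.real K) := by
        field_simp
    _ ≤ _ := mul_le_mul_of_nonneg_left hle hv.le

/-! ### The equality case forces a regular polygon. -/

/-- A closed subset of full measure of a convex set with interior points is everything. -/
theorem Convex.subset_of_measure_le {A B : Set Plane} (hA : Convex ℝ A)
    (hint : (interior A).Nonempty) (hB : IsClosed B) (hBA : B ⊆ A) (hfin : volume A ≠ ⊤)
    (hle : volume A ≤ volume B) : A ⊆ B := by
  intro p hp
  by_contra hpB
  have hpc : p ∈ closure (interior A) := by
    rw [hA.closure_interior_eq_closure_of_nonempty_interior hint]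
    exact subset_closure hp
  obtain ⟨q, hqB, hqA⟩ := mem_closure_iff.1 hpc _ hB.isOpen_compl hpB
  have hpos : 0 < volume (Bᶜ ∩ interior A) :=
    (hB.isOpen_compl.inter isOpen_interior).measure_pos _ ⟨q, hqB, hqA⟩
  have hsub : Bᶜ ∩ interior A ⊆ A \ B := fun z hz => ⟨interior_subset hz.2, hz.1⟩
  have hzero : volume (A \ B) = 0 := by
    rw [measure_sdiff hBA hB.measurableSet.nullMeasurableSet (measure_ne_top_of_subset hBA hfin),
      tsub_eq_zero_of_le hle]
  exact (hpos.trans_le (measure_mono hsub)).ne' hzero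

/-- Under equality the dilated rotated copy of K inside the polar body has the same area, and it is
closed. -/
theorem HasRotationalSymmetry.polarBody_subset_of_eq {n : ℕ} (hn : 3 ≤ n) {K : Set Plane}
    (h : HasRotationalSymmetry n K) (hK : Convex ℝ K) (hc : IsCompact K)
    (h0 : (0 : Plane) ∈ interior K)
    (heq : volume.real K * volume.real (polarBody K) =
      (n : ℝ) ^ 2 * Real.sin (Real.pi / n) ^ 2) :
    polarBody K ⊆ (fun x => (n * Real.sin (Real.pi / n) / volume.real K) •
      planeRotation (Real.pi / n) x) '' K := by
  have hv := volume_real_pos hc ⟨0, h0⟩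
  have hs := sin_pi_div_pos hn
  have hn0 : 0 < (n : ℝ) := by positivity
  set c := n * Real.sin (Real.pi / n) / volume.real K with hcdef
  have hcpos : 0 < c := by positivity
  have hsub := h.image_subset_polarBody hn hK hc h0
  have hvK : volume.real ((fun x => c • planeRotation (Real.pi / n) x) '' K) =
      volume.real (polarBody K) := by
    rw [volume_real_image_smul_planeRotation]
    apply mul_left_cancel₀ hv.ne'
    rw [heq, hcdef]
    field_simp
  have hcompact : IsCompact ((fun x => c • planeRotation (Real.pi / n) x) '' K) :=
    hc.image ((continuous_planeRotation _).const_smul c)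
  have hfin : volume (polarBody K) ≠ ⊤ := (isBounded_polarBody h0).measure_lt_top.ne
  refine (convex_polarBody K).subset_of_measure_le ?_ hcompact.isClosed hsub hfin ?_
  · by_contra hempty
    -- A closed set with empty interior is its own frontier, and the frontier of a convex set is
    -- null.
    have hz : volume (polarBody K) = 0 := by
      have hf := (convex_polarBody K).addHaar_frontier volume
      rwa [(isClosed_polarBody K).frontier_eq, Set.not_nonempty_iff_eq_empty.1 hempty,
        Set.sdiff_empty] at hf
    have : volume.real (polarBody K) = 0 := by rw [Measure.real, hz, ENNReal.toReal_zero]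
    rw [this, mul_zero] at heq
    exact (by positivity : (n : ℝ) ^ 2 * Real.sin (Real.pi / n) ^ 2 ≠ 0) heq.symm
  · exact ((ENNReal.toReal_eq_toReal_iff' hcompact.measure_lt_top.ne hfin).1 hvK).ge

/-- In the equality case every boundary point has a matching point of `K`, at which the polar
inequality is sharp. -/
theorem HasRotationalSymmetry.exists_inner_ge_of_eq {n : ℕ} (hn : 3 ≤ n) {K : Set Plane}
    (h : HasRotationalSymmetry n K) (hK : Convex ℝ K) (hc : IsCompact K)
    (h0 : (0 : Plane) ∈ interior K)
    (heq : volume.real K * volume.real (polarBody K) =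
      (n : ℝ) ^ 2 * Real.sin (Real.pi / n) ^ 2)
    {x : Plane} (hx : x ∈ K) (hxi : x ∉ interior K) :
    ∃ y ∈ K, volume.real K ≤
      n * Real.sin (Real.pi / n) * inner ℝ (planeRotation (Real.pi / n) x) y := by
  have hv := volume_real_pos hc ⟨0, h0⟩
  have hs := sin_pi_div_pos hn
  have hn0 : 0 < (n : ℝ) := by positivity
  obtain ⟨y, hy, hmax⟩ := hc.exists_isMaxOn (f := fun y => inner ℝ (planeRotation (Real.pi / n) x) y)
    ⟨x, hx⟩ (continuous_const.inner continuous_id).continuousOn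
  refine ⟨y, hy, ?_⟩
  by_contra! hlt
  set m := n * Real.sin (Real.pi / n) * inner ℝ (planeRotation (Real.pi / n) x) y with hm
  have hm0 : 0 ≤ m := by
    have : inner ℝ (planeRotation (Real.pi / n) x) (0 : Plane) ≤
      inner ℝ (planeRotation (Real.pi / n) x) y := hmax (interior_subset h0)
    rw [inner_zero_right] at this
    positivity
  set c := n * Real.sin (Real.pi / n) / volume.real K with hcdef
  have hcpos : 0 < c := by positivity
  have hsm : 0 < volume.real K + m := by positivity
  -- This t satisfies t > 1 and t·m ≤ |K| because 0 ≤ m < |K|, and it avoids dividing by m, which is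
  -- not yet known to be nonzero. Then t·cρx is polar to K, so tx ∈ K, contradicting that x is not
  -- interior.
  set t := 2 * volume.real K / (volume.real K + m) with ht
  have ht1 : 1 < t := by rw [ht, one_lt_div hsm]; linarith
  have htm : t * m ≤ volume.real K := by
    rw [ht, div_mul_eq_mul_div, div_le_iff₀ hsm]; nlinarith
  have hpol : t • c • planeRotation (Real.pi / n) x ∈ polarBody K := by
    intro z hz
    have hzy : inner ℝ (planeRotation (Real.pi / n) x) z ≤
      inner ℝ (planeRotation (Real.pi / n) x) y := hmax hz
    rw [real_inner_smul_left, real_inner_smul_left]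
    calc t * (c * inner ℝ (planeRotation (Real.pi / n) x) z)
        ≤ t * (c * inner ℝ (planeRotation (Real.pi / n) x) y) := by gcongr
      _ = t * m / volume.real K := by rw [hm, hcdef]; ring
      _ ≤ 1 := (div_le_one hv).2 htm
  obtain ⟨z, hz, hze⟩ := h.polarBody_subset_of_eq hn hK hc h0 heq hpol
  have hzx : z = t • x := by
    have := congrArg (planeRotation (-(Real.pi / n))) hze
    simp only [planeRotation_smul, planeRotation_neg_cancel] at this
    rw [smul_comm] at this
    exact smul_right_injective _ hcpos.ne' this
  apply hxi
  have := smul_mem_interior_of_lt_one hK h0 hz (s := t⁻¹) (by positivity) (inv_lt_one_of_one_lt₀ ht1)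
  rwa [hzx, inv_smul_smul₀ (by positivity)] at this

theorem openTriangle_subset_convexHull (u v : Plane) {S : Set Plane} (h0 : (0 : Plane) ∈ S)
    (hu : u ∈ S) (hv : v ∈ S) : openTriangle u v ⊆ convexHull ℝ S :=
  openTriangle_subset (convex_convexHull ℝ S) (subset_convexHull ℝ S h0)
    (subset_convexHull ℝ S hu) (subset_convexHull ℝ S hv)

/-- In the equality case the extreme points of `K` form at most two orbits, one of which can be
prescribed to be the orbit of a boundary point. -/
theorem HasRotationalSymmetry.exists_extremePoints_subset_of_eq {n : ℕ} (hn : 3 ≤ n) {K : Set Plane}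
    (h : HasRotationalSymmetry n K) (hK : Convex ℝ K) (hc : IsCompact K)
    (h0 : (0 : Plane) ∈ interior K)
    (heq : volume.real K * volume.real (polarBody K) =
      (n : ℝ) ^ 2 * Real.sin (Real.pi / n) ^ 2)
    {x : Plane} (hx : x ∈ K) (hxi : x ∉ interior K) :
    ∃ y ∈ K, ∀ e ∈ K.extremePoints ℝ,
      (∃ k : ℕ, k ≤ n ∧ e = planeRotation (k * (2 * Real.pi / n)) x) ∨
        ∃ k : ℕ, k < n ∧ e = planeRotation (k * (2 * Real.pi / n)) y := by
  have hx0 := ne_zero_of_notMem_interior h0 hxi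
  have hs := sin_pi_div_pos hn
  obtain ⟨y, hy, hvol⟩ := h.exists_inner_ge_of_eq hn hK hc h0 heq hx hxi
  obtain ⟨α, β, hα, hβ, hmem, hle⟩ := h.exists_mem_sector hn hK h0 hx hxi hy
  set z := α • x + β • planeRotation (2 * Real.pi / n) x with hz
  refine ⟨z, hmem, ?_⟩
  -- The vertices of the k-th quadrilateral. For k = n − 1 the last one has rotation index n, hence
  -- the bound k ≤ n for the orbit of x.
  let F : Fin n → Set Plane := fun k => {0, planeRotation (k * (2 * Real.pi / n)) x,
    planeRotation (k * (2 * Real.pi / n)) z,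
    planeRotation ((k + 1 : ℕ) * (2 * Real.pi / n)) x}
  have hF : ∀ k, F k ⊆ K := by
    rintro k w (rfl | rfl | rfl | rfl)
    exacts [interior_subset h0, h.planeRotation_mem hx _, h.planeRotation_mem hmem _,
      h.planeRotation_mem hx _]
  have hhull : ∀ k, convexHull ℝ (F k) ⊆ K := fun k => convexHull_min (hF k) hK
  have hsub : (⋃ k : Fin n, planeRotation (k * (2 * Real.pi / n)) ''
      (openTriangle x z ∪ openTriangle z (planeRotation (2 * Real.pi / n) x))) ⊆
      ⋃ k, convexHull ℝ (F k) := by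
    refine Set.iUnion_mono fun k => ?_
    rw [Set.image_union, image_planeRotation_openTriangle, image_planeRotation_openTriangle,
      planeRotation_rotation]
    have e : (k : ℝ) * (2 * Real.pi / n) + 2 * Real.pi / n =
        ((k + 1 : ℕ) : ℝ) * (2 * Real.pi / n) := by push_cast; ring
    rw [e]
    exact Set.union_subset
      (openTriangle_subset_convexHull _ _ (by simp [F]) (by simp [F]) (by simp [F]))
      (openTriangle_subset_convexHull _ _ (by simp [F]) (by simp [F]) (by simp [F]))
  -- The hulls form a closed subset of K of full measure.
  have hKsub : K ⊆ ⋃ k, convexHull ℝ (F k) := by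
    refine hK.subset_of_measure_le ⟨0, h0⟩
      (isClosed_iUnion_of_finite fun k => ((Set.toFinite (F k)).isClosed_convexHull ℝ))
      (Set.iUnion_subset hhull) hc.measure_lt_top.ne ?_
    refine le_trans ?_ (measure_mono hsub)
    rw [volume_iUnion_rotated_triangles hn hx0 hα hβ hz,
      ← ENNReal.ofReal_toReal hc.measure_lt_top.ne]
    exact ENNReal.ofReal_le_ofReal
      (hvol.trans (mul_le_mul_of_nonneg_left hle (by positivity)))
  intro e he
  obtain ⟨k, hk⟩ := Set.mem_iUnion.1 (hKsub he.1)
  have heF : e ∈ F k := extremePoints_convexHull_subset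
    (inter_extremePoints_subset_extremePoints_of_subset (hhull k) ⟨hk, he⟩)
  rcases heF with rfl | rfl | rfl | rfl
  -- The origin is not extreme: it is the midpoint of two small opposite multiples of x in K.
  · exfalso
    have hKn : K ∈ nhds (0 : Plane) := mem_interior_iff_mem_nhds.1 h0
    obtain ⟨δ, hδ, hball⟩ := Metric.mem_nhds_iff.1 hKn
    have hxn : 0 < ‖x‖ := norm_pos_iff.2 hx0
    have hb : ∀ s : ℝ, |s| = δ / 2 / ‖x‖ → s • x ∈ K := fun s hs => by
      apply hball
      rw [mem_ball_zero_iff, norm_smul, Real.norm_eq_abs, hs, div_mul_cancel₀ _ hxn.ne']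
      linarith
    have hpos : 0 < δ / 2 / ‖x‖ := by positivity
    have := he.2 (hb _ (abs_of_pos hpos)) (hb (-(δ / 2 / ‖x‖)) (by rw [abs_neg, abs_of_pos hpos]))
      ⟨1 / 2, 1 / 2, by norm_num, by norm_num, by norm_num, by module⟩
    rcases smul_eq_zero.1 this with h1 | h1
    exacts [hpos.ne' h1, hx0 h1]
  · exact Or.inl ⟨k, k.2.le, rfl⟩
  · exact Or.inr ⟨k, k.2, rfl⟩
  · exact Or.inl ⟨k + 1, k.2, rfl⟩

theorem HasRotationalSymmetry.mem_extremePoints_of_rotation {n : ℕ} {K : Set Plane}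
    (h : HasRotationalSymmetry n K) {x : Plane} (hx : x ∈ K) (k : ℕ)
    (hk : planeRotation (k * (2 * Real.pi / n)) x ∈ K.extremePoints ℝ) :
    x ∈ K.extremePoints ℝ := by
  refine ⟨hx, fun a ha b hb ⟨s, t, hs, ht, hst, hab⟩ => ?_⟩
  have := hk.2 (h.planeRotation_mem ha k) (h.planeRotation_mem hb k)
    ⟨s, t, hs, ht, hst, by rw [← hab, planeRotation_add, planeRotation_smul, planeRotation_smul]⟩
  rw [← planeRotation_neg_cancel (k * (2 * Real.pi / n)) a, this, planeRotation_neg_cancel]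

/-- The boundary of a planar convex body is infinite. -/
theorem infinite_frontier {K : Set Plane} (hK : Convex ℝ K) (hc : IsCompact K)
    (h0 : (0 : Plane) ∈ interior K) : (frontier K).Infinite := by
  have hnhds : K ∈ nhds (0 : Plane) := mem_interior_iff_mem_nhds.1 h0
  -- Radial projection of the line of points (1, t) to the frontier is injective: the first
  -- coordinate recovers the scaling factor, then the second recovers t.
  let v : ℝ → Plane := fun t => !₂[1, t]
  have hv : ∀ t, v t ≠ 0 := fun t ht => by
    have := congrArg (fun p : Plane => p 0) ht
    simp [v] at this
  have hg : ∀ t, 0 < gauge K (v t) := fun t =>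
    (gauge_pos (absorbent_nhds_zero hnhds) ((NormedSpace.isVonNBounded_iff ℝ).2 hc.isBounded)).2 (hv t)
  refine Set.infinite_of_injective_forall_mem (f := fun t : ℝ => (gauge K (v t))⁻¹ • v t) ?_ ?_
  · intro s t hst
    have e0 := congrArg (fun p : Plane => p 0) hst
    have e1 := congrArg (fun p : Plane => p 1) hst
    simp [v] at e0 e1
    rw [e0] at e1
    exact mul_left_cancel₀ (inv_pos.2 (hg t)).ne' e1
  · intro t
    rw [← gauge_eq_one_iff_mem_frontier hK hnhds, gauge_smul_of_nonneg (inv_pos.2 (hg t)).le,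
      smul_eq_mul, inv_mul_cancel₀ (hg t).ne']

theorem HasRotationalSymmetry.isRegularPolygon_of_eq {n : ℕ} (hn : 3 ≤ n) {K : Set Plane}
    (h : HasRotationalSymmetry n K) (hK : Convex ℝ K) (hc : IsCompact K)
    (h0 : (0 : Plane) ∈ interior K)
    (heq : volume.real K * volume.real (polarBody K) =
      (n : ℝ) ^ 2 * Real.sin (Real.pi / n) ^ 2) : IsRegularPolygon n K := by
  have hinf := infinite_frontier hK hc h0
  have hfr : frontier K = K \ interior K := hc.isClosed.frontier_eq
  have hfin : (K.extremePoints ℝ).Finite := by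
    obtain ⟨x, hx⟩ := hinf.nonempty
    rw [hfr] at hx
    obtain ⟨y, -, hy⟩ := h.exists_extremePoints_subset_of_eq hn hK hc h0 heq hx.1 hx.2
    refine (((Set.finite_Iic n).image fun k : ℕ => planeRotation (k * (2 * Real.pi / n)) x).union
      ((Set.finite_Iio n).image fun k : ℕ => planeRotation (k * (2 * Real.pi / n)) y)).subset ?_
    intro e he
    rcases hy e he with ⟨k, hk, rfl⟩ | ⟨k, hk, rfl⟩
    exacts [Or.inl ⟨k, hk, rfl⟩, Or.inr ⟨k, hk, rfl⟩]
  -- With a non-extreme boundary point x, no point of its orbit is extreme, so the second use of the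
  -- two-orbit lemma leaves only the orbit of y.
  obtain ⟨x, hx, hxe⟩ := (hinf.sdiff hfin).nonempty
  rw [hfr] at hx
  obtain ⟨y, hyK, hy⟩ := h.exists_extremePoints_subset_of_eq hn hK hc h0 heq hx.1 hx.2
  set V : Fin n → Plane := fun k => planeRotation (k * (2 * Real.pi / n)) y with hV
  have hext : K.extremePoints ℝ ⊆ Set.range V := by
    intro e he
    rcases hy e he with ⟨k, -, rfl⟩ | ⟨k, hk, rfl⟩
    · exact (hxe (h.mem_extremePoints_of_rotation hx.1 k he)).elim
    · exact ⟨⟨k, hk⟩, rfl⟩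
  have hKV : K = convexHull ℝ (Set.range V) := by
    apply Set.Subset.antisymm
    · conv_lhs => rw [← closure_convexHull_extremePoints hc hK]
      exact closure_minimal (convexHull_mono hext) ((Set.finite_range V).isClosed_convexHull ℝ)
    · refine convexHull_min ?_ hK
      rintro _ ⟨k, rfl⟩
      exact h.planeRotation_mem hyK k
  have hy0 : y ≠ 0 := by
    rintro rfl
    have hV0 : Set.range V ⊆ {0} := by
      rintro _ ⟨k, rfl⟩
      simp [hV, ← rotationLin_apply]
    have hK0 : K ⊆ {0} := by
      rw [hKV]
      exact convexHull_min hV0 (convex_singleton 0)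
    exact hx.2 (by rw [Set.mem_singleton_iff.1 (hK0 hx.1)]; exact h0)
  set w : ℂ := ⟨y 0, y 1⟩ with hw
  have hw0 : 0 < ‖w‖ := by
    rw [norm_pos_iff]
    intro hw0
    apply hy0
    have hre : w.re = 0 := by rw [hw0]; rfl
    have him : w.im = 0 := by rw [hw0]; rfl
    exact plane_ext (by simpa [hw] using hre) (by simpa [hw] using him)
  have e0 : ‖w‖ * Real.cos w.arg = y 0 := by rw [Complex.norm_mul_cos_arg]
  have e1 : ‖w‖ * Real.sin w.arg = y 1 := by rw [Complex.norm_mul_sin_arg]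
  refine ⟨0, ‖w‖, w.arg, hw0, ?_⟩
  conv_lhs => rw [hKV]
  congr 2
  ext1 k
  have ek : 2 * Real.pi * k / n = k * (2 * Real.pi / n) := by ring
  rw [ek]
  apply plane_ext <;>
    simp only [hV, planeRotation_apply_zero, planeRotation_apply_one, Real.cos_add, Real.sin_add,
      zero_add, PiLp.smul_apply, smul_eq_mul, Matrix.cons_val_zero,
      Matrix.cons_val_one]
  · linear_combination -Real.cos (k * (2 * Real.pi / n)) * e0 +
      Real.sin (k * (2 * Real.pi / n)) * e1
  · linear_combination -Real.sin (k * (2 * Real.pi / n)) * e0 -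
      Real.cos (k * (2 * Real.pi / n)) * e1

/-! ### Regular polygons attain equality. -/

theorem inner_planeRotation_planeRotation (A B : ℝ) (v : Plane) :
    inner ℝ (planeRotation A v) (planeRotation B v) = Real.cos (A - B) * (v 0 ^ 2 + v 1 ^ 2) := by
  simp only [plane_inner, planeRotation_apply_zero, planeRotation_apply_one, Real.cos_sub]
  ring

theorem norm_planeRotation (θ : ℝ) (v : Plane) : ‖planeRotation θ v‖ = ‖v‖ := by
  rw [← sq_eq_sq₀ (norm_nonneg _) (norm_nonneg _), ← real_inner_self_eq_norm_sq,
    ← real_inner_self_eq_norm_sq, inner_planeRotation]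

/-- A regular `n`-gon with `n`-fold symmetry about the origin is centred at the origin. -/
theorem HasRotationalSymmetry.center_eq_zero {n : ℕ} (hn : 3 ≤ n) {K : Set Plane}
    (h : HasRotationalSymmetry n K) {c v : Plane}
    (hK : K = convexHull ℝ
      (Set.range fun k : Fin n => c + planeRotation (k * (2 * Real.pi / n)) v)) : c = 0 := by
  apply eq_zero_of_planeRotation_eq hn
  have hball : K ⊆ Metric.closedBall c ‖v‖ := by
    rw [hK]
    refine convexHull_min ?_ (convex_closedBall _ _)
    rintro _ ⟨k, rfl⟩
    simp [norm_planeRotation]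
  set w := planeRotation (2 * Real.pi / n) c - c with hw
  -- The rotated vertex stays in the circumscribed disc about c; expanding the square of its
  -- distance to c gives this. Summing over k kills the linear term and leaves w = 0.
  have hle : ∀ k ∈ Finset.range n, ‖w‖ ^ 2 + 2 * inner ℝ w
      (planeRotation (2 * Real.pi / n) (planeRotation (k * (2 * Real.pi / n)) v)) ≤ 0 := by
    intro k hk
    have hmem : c + planeRotation (k * (2 * Real.pi / n)) v ∈ K := by
      rw [hK]
      exact subset_convexHull ℝ _ ⟨⟨k, Finset.mem_range.1 hk⟩, rfl⟩
    have hb := hball (h.step_mem hmem)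
    rw [planeRotation_add, mem_closedBall_iff_norm, add_sub_right_comm, ← hw] at hb
    have := pow_le_pow_left₀ (norm_nonneg _) hb 2
    rw [norm_add_sq_real, norm_planeRotation, norm_planeRotation] at this
    linarith
  have hsum := Finset.sum_nonpos hle
  rw [Finset.sum_add_distrib, ← Finset.mul_sum, ← inner_sum] at hsum
  have hz : ∑ k ∈ Finset.range n, planeRotation (2 * Real.pi / n)
      (planeRotation (k * (2 * Real.pi / n)) v) = 0 := by
    simp only [← rotationLin_apply (2 * Real.pi / n)]
    rw [← map_sum, sum_rotations_eq_zero hn, map_zero]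
  rw [hz, inner_zero_right, mul_zero, add_zero, Finset.sum_const, Finset.card_range,
    nsmul_eq_mul] at hsum
  have hn0 : (0 : ℝ) < n := by positivity
  have : ‖w‖ ^ 2 = 0 := le_antisymm (nonpos_of_mul_nonpos_right hsum hn0) (sq_nonneg _)
  exact sub_eq_zero.1 (norm_eq_zero.1 (pow_eq_zero_iff two_ne_zero |>.1 this))

/-- The hypotheses are the side inequalities of the polygon. Only that of the sector containing z is
needed: there it reads a + b ≤ 1. -/
theorem mem_iUnion_closedTriangle {n : ℕ} (hn : 3 ≤ n) {v : Plane} (hv : v ≠ 0) {z : Plane}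
    (hz : ∀ k : Fin n, inner ℝ
      (planeRotation (k * (2 * Real.pi / n)) (planeRotation (Real.pi / n) v)) z ≤
        Real.cos (Real.pi / n) * (v 0 ^ 2 + v 1 ^ 2)) :
    z ∈ ⋃ k : Fin n, planeRotation (k * (2 * Real.pi / n)) ''
      closedTriangle v (planeRotation (2 * Real.pi / n) v) := by
  obtain ⟨h1, h2, h3⟩ := two_pi_div_bounds hn
  obtain ⟨k, a, b, ha, hb, rfl⟩ := exists_rotated_sector h1 h2 h3 hv z
  have h := hz k
  rw [inner_planeRotation, inner_rotation_sector] at h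
  have hd := mul_pos (cos_pi_div_pos hn) (plane_ne_zero hv)
  exact Set.mem_iUnion.2 ⟨k, _, ⟨a, b, ha, hb, by nlinarith, rfl⟩, rfl⟩

theorem volume_iUnion_closedTriangle_le {n : ℕ} (hn : 3 ≤ n) (v : Plane) :
    volume (⋃ k : Fin n, planeRotation (k * (2 * Real.pi / n)) ''
      closedTriangle v (planeRotation (2 * Real.pi / n) v)) ≤
    ENNReal.ofReal (n * (Real.sin (2 * Real.pi / n) * (v 0 ^ 2 + v 1 ^ 2) / 2)) := by
  obtain ⟨h1, h2, h3⟩ := two_pi_div_bounds hn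
  have hs := Real.sin_pos_of_pos_of_lt_pi h1 h2
  refine (measure_iUnion_fintype_le _ _).trans ?_
  simp only [volume_image_planeRotation, Finset.sum_const, Finset.card_univ, Fintype.card_fin]
  rw [nsmul_eq_mul, ENNReal.ofReal_mul (Nat.cast_nonneg n), ENNReal.ofReal_natCast]
  gcongr
  refine (volume_closedTriangle_le _ _).trans_eq ?_
  rw [planeDet_self_planeRotation, abs_of_nonneg (by positivity)]

/-- Up to sign the angle is an odd multiple of π/n between π/n and 2π − π/n. The lemma says that
every vertex satisfies every side inequality. -/
theorem cos_odd_multiple_le {n : ℕ} (hn : 3 ≤ n) (j k : Fin n) :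
    Real.cos (k * (2 * Real.pi / n) + Real.pi / n - j * (2 * Real.pi / n)) ≤
      Real.cos (Real.pi / n) := by
  obtain ⟨h1, h2, h3⟩ := two_pi_div_bounds hn
  have hn0 : (0 : ℝ) < n := by positivity
  set φ := Real.pi / n with hφ
  have h2φ : 2 * Real.pi / n = 2 * φ := by rw [hφ]; ring
  rw [h2φ] at h1 h2 h3 ⊢
  have hj : (j : ℝ) + 1 ≤ n := by exact_mod_cast j.2
  have hk : (k : ℝ) + 1 ≤ n := by exact_mod_cast k.2
  have hj0 : (0 : ℝ) ≤ j := by positivity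
  have hk0 : (0 : ℝ) ≤ k := by positivity
  have key : ∀ t : ℝ, φ ≤ t → t ≤ 2 * Real.pi - φ → Real.cos t ≤ Real.cos φ := by
    intro t ht1 ht2
    rcases le_total t Real.pi with ht | ht
    · exact Real.cos_le_cos_of_nonneg_of_le_pi (by linarith) ht ht1
    · rw [← Real.cos_two_pi_sub t]
      exact Real.cos_le_cos_of_nonneg_of_le_pi (by linarith) (by linarith) (by linarith)
  rcases le_or_gt (j : ℕ) (k : ℕ) with hjk | hjk
  · have hjk' : (j : ℝ) ≤ k := by exact_mod_cast hjk
    exact key _ (by nlinarith) (by nlinarith)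
  · have hjk' : (k : ℝ) + 1 ≤ j := by exact_mod_cast hjk
    rw [← Real.cos_neg]
    exact key _ (by nlinarith) (by nlinarith)

theorem HasRotationalSymmetry.volume_product_le_of_isRegularPolygon {n : ℕ} (hn : 3 ≤ n)
    {K : Set Plane} (h : HasRotationalSymmetry n K) (hreg : IsRegularPolygon n K) :
    volume.real K * volume.real (polarBody K) ≤ (n : ℝ) ^ 2 * Real.sin (Real.pi / n) ^ 2 := by
  obtain ⟨c, r, ψ, hr, hK⟩ := hreg
  set v : Plane := r • !₂[Real.cos ψ, Real.sin ψ] with hv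
  have hvert : ∀ k : Fin n, r • (!₂[Real.cos (ψ + 2 * Real.pi * k / n),
      Real.sin (ψ + 2 * Real.pi * k / n)] : Plane) =
        planeRotation (k * (2 * Real.pi / n)) v := by
    intro k
    have ek : 2 * Real.pi * k / n = k * (2 * Real.pi / n) := by ring
    rw [ek]
    apply plane_ext <;>
      simp [hv, planeRotation_apply_zero, planeRotation_apply_one, Real.cos_add, Real.sin_add] <;>
      ring
  simp only [hvert] at hK
  obtain rfl := h.center_eq_zero hn hK
  simp only [zero_add] at hK
  have hvsq : v 0 ^ 2 + v 1 ^ 2 = r ^ 2 := by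
    simp [hv]
    linear_combination r ^ 2 * Real.sin_sq_add_cos_sq ψ
  have hv0 : v ≠ 0 := by
    intro h0
    rw [h0] at hvsq
    simp at hvsq
    exact (pow_pos hr 2).ne' hvsq.symm
  have hcos := cos_pi_div_pos hn
  set d := Real.cos (Real.pi / n) * (v 0 ^ 2 + v 1 ^ 2) with hd
  have hd0 : 0 < d := mul_pos hcos (plane_ne_zero hv0)
  have hvertK : ∀ k : Fin n, planeRotation (k * (2 * Real.pi / n)) v ∈ K := fun k => by
    rw [hK]
    exact subset_convexHull ℝ _ ⟨k, rfl⟩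
  set U := ⋃ k : Fin n, planeRotation (k * (2 * Real.pi / n)) ''
      closedTriangle v (planeRotation (2 * Real.pi / n) v) with hU
  have hKU : K ⊆ U := by
    intro z hz
    refine mem_iUnion_closedTriangle hn hv0 fun k => ?_
    have hhalf : Convex ℝ {z : Plane | inner ℝ
        (planeRotation (k * (2 * Real.pi / n)) (planeRotation (Real.pi / n) v)) z ≤ d} :=
      convex_halfSpace_le ⟨fun _ _ => inner_add_right _ _ _,
        fun _ _ => real_inner_smul_right _ _ _⟩ d
    rw [hK] at hz
    refine convexHull_min ?_ hhalf hz
    rintro _ ⟨j, rfl⟩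
    rw [Set.mem_ofPred_eq, planeRotation_rotation, inner_planeRotation_planeRotation]
    exact mul_le_mul_of_nonneg_right (cos_odd_multiple_le hn j k) (plane_ne_zero hv0).le
  -- After rotation through π/n and scaling by d, the polar constraint at the k-th vertex becomes
  -- the k-th side inequality.
  have hpolU : (fun x => d • planeRotation (Real.pi / n) x) '' polarBody K ⊆ U := by
    rintro _ ⟨z, hz, rfl⟩
    refine mem_iUnion_closedTriangle hn hv0 fun k => ?_
    rw [planeRotation_rotation, add_comm, ← planeRotation_rotation, real_inner_smul_right,
      inner_planeRotation, real_inner_comm]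
    exact mul_le_of_le_one_right hd0.le (hz _ (hvertK k))
  have hUle := volume_iUnion_closedTriangle_le hn v
  rw [← hU] at hUle
  have hUfin : volume U ≠ ⊤ := (hUle.trans_lt ENNReal.ofReal_lt_top).ne
  obtain ⟨h1, h2, -⟩ := two_pi_div_bounds hn
  have hsinθ := Real.sin_pos_of_pos_of_lt_pi h1 h2
  set S := n * (Real.sin (2 * Real.pi / n) * (v 0 ^ 2 + v 1 ^ 2) / 2) with hS
  have hS0 : 0 ≤ S := by positivity
  have hUr : volume.real U ≤ S := ENNReal.toReal_le_of_le_ofReal hS0 hUle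
  have hA : volume.real K ≤ S := (measureReal_mono hKU hUfin).trans hUr
  have hB : d ^ 2 * volume.real (polarBody K) ≤ S := by
    rw [← volume_real_image_smul_planeRotation d (Real.pi / n)]
    exact (measureReal_mono hpolU hUfin).trans hUr
  have hprod : volume.real K * (d ^ 2 * volume.real (polarBody K)) ≤ S * S :=
    mul_le_mul hA hB (by positivity) hS0
  have hSd : S = n * Real.sin (Real.pi / n) * d := by
    have e : 2 * Real.pi / n = 2 * (Real.pi / n) := by ring
    rw [hS, hd, e, Real.sin_two_mul]; ring
  rw [hSd] at hprod
  have hd2 : 0 < d ^ 2 := by positivity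
  refine le_of_mul_le_mul_left ?_ hd2
  linarith

theorem corollary4 (n : ℕ) (hn : 3 ≤ n) (K : ConvexBody Plane)
    (hint : (interior (K : Set Plane)).Nonempty)
    (hsymm : HasRotationalSymmetry n (K : Set Plane)) :
    (n : ℝ) ^ 2 * Real.sin (Real.pi / n) ^ 2 ≤
        volume.real (K : Set Plane) * volume.real (polarBody (K : Set Plane)) ∧
      (volume.real (K : Set Plane) * volume.real (polarBody (K : Set Plane)) =
          (n : ℝ) ^ 2 * Real.sin (Real.pi / n) ^ 2 ↔
        IsRegularPolygon n (K : Set Plane)) := by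
  have h0 := hsymm.zero_mem_interior hn K.convex hint
  have hge := hsymm.volume_product_ge hn K.convex K.isCompact h0
  exact ⟨hge, fun heq => hsymm.isRegularPolygon_of_eq hn K.convex K.isCompact h0 heq,
    fun hreg => le_antisymm (hsymm.volume_product_le_of_isRegularPolygon hn hreg) hge⟩
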